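/- Let $A\in\mathbb{R}^{n\times n}$, $B\in\mathbb{R}^{n\times m}$, $C\in\mathbb{R}^{n\times p}$, and let $\mathcal{U}\subseteq\mathbb{R}^m$, $\mathcal{W}\subseteq\mathbb{R}^p$ be compact sets such that $\mathcal{U}\times\mathcal{W}$ is a (closed, nonempty) hyperrectangle of $\mathbb{R}^{m+p}$. Consider the control system $$\dot x(t)=Ax(t)+Bu(t)+Cw(t),\qquad x(0)=x_0,\qquad u(t)\in\mathcal{U},\ w(t)\in\mathcal{W},$$ where $u$ is the controlled input and $w$ the undesirable input. The system is called \emph{resilient} if for all $x_0,x_{goal}\in\mathbb{R}^n$ and every piecewise continuous $w:[0,\infty)\to\mathcal{W}$ there exist $T>0$ and a piecewise continuous $u:[0,\infty)\to\mathcal{U}$ such that the solution $x$ of the system exists, is unique, and satisfies $x(T)=x_{goal}$. Put $$\mathcal{Z}:=\{z\in B\mathcal{U}\ :\ z-Cw\in B\mathcal{U}\ \text{for all}\ w\in\mathcal{W}\},\qquad B\mathcal{U}:=\{Bu:u\in\mathcal{U}\}.$$ If $0\in\operatorname{int}(\mathcal{Z})$ (interior in $\mathbb{R}^n$) and every complex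 eigenvalue of $A$ has real part equal to $0$, then the system is resilient. -/

import Mathlib

open Set Filter Topology

/-- A closed, bounded, nonempty hyperrectangle `∏ᵢ [lo i, hi i]`. -/
def IsHyperrectangle {ι : Type*} (S : Set (ι → ℝ)) : Prop :=
  ∃ lo hi : ι → ℝ, lo ≤ hi ∧ S = Set.Icc lo hi

/-- The set of all joint inputs `(u, w)` with `u ∈ U` and `w ∈ W`, i.e. the product `U × W`
viewed as a subset of `ℝ^(m+p)`. -/
def jointInputSet {m p : ℕ} (U : Set (Fin m → ℝ)) (W : Set (Fin p → ℝ)) :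
    Set (Fin m ⊕ Fin p → ℝ) :=
  {v | (fun i => v (Sum.inl i)) ∈ U ∧ (fun j => v (Sum.inr j)) ∈ W}

/-- The Pontryagin difference `{z ∈ X : z + y ∈ X for all y ∈ Y}`. -/
def pontryaginDiff {n : ℕ} (X Y : Set (Fin n → ℝ)) : Set (Fin n → ℝ) :=
  {z | z ∈ X ∧ ∀ y ∈ Y, z + y ∈ X}

/-- The set `BU = {B u : u ∈ U}`. -/
def matImage {n m : ℕ} (B : Matrix (Fin n) (Fin m) ℝ) (U : Set (Fin m → ℝ)) :
    Set (Fin n → ℝ) :=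
  {y | ∃ u ∈ U, y = B.mulVec u}

/-- The set `Z`, the Pontryagin difference of `BU` and `-CW = (-C)W`. -/
def dualInputSet {n m p : ℕ} (B : Matrix (Fin n) (Fin m) ℝ) (C : Matrix (Fin n) (Fin p) ℝ)
    (U : Set (Fin m → ℝ)) (W : Set (Fin p → ℝ)) : Set (Fin n → ℝ) :=
  pontryaginDiff (matImage B U) (matImage (-C) W)

/-- The set of (complex) eigenvalues of a real square matrix. -/
def eigenvalueSet {n : ℕ} (A : Matrix (Fin n) (Fin n) ℝ) : Set ℂ :=
  {μ | Module.End.HasEigenvalue (Matrix.toLin' (A.map Complex.ofReal)) μ}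

/-- `f` is piecewise continuous on `[0, ∞)`: on every bounded interval `[0, T]` it has finitely
many discontinuities, and it has finite one-sided limits everywhere. Values of `f` at negative
times are irrelevant. -/
def IsPiecewiseContinuous {k : ℕ} (f : ℝ → (Fin k → ℝ)) : Prop :=
  (∀ T : ℝ, {t : ℝ | t ∈ Set.Icc 0 T ∧ ¬ ContinuousWithinAt f (Set.Ici 0) t}.Finite) ∧
  (∀ t : ℝ, 0 ≤ t → ∃ l, Tendsto f (𝓝[>] t) (𝓝 l)) ∧
  (∀ t : ℝ, 0 < t → ∃ l, Tendsto f (𝓝[<] t) (𝓝 l))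

/-- Admissible signals: piecewise continuous functions `[0, ∞) → S`. -/
def IsAdmissibleSignal {k : ℕ} (S : Set (Fin k → ℝ)) (f : ℝ → (Fin k → ℝ)) : Prop :=
  IsPiecewiseContinuous f ∧ ∀ t : ℝ, 0 ≤ t → f t ∈ S

/-- `x` is a solution on `[0, ∞)` of `x' = A x + B u + C w`, `x(0) = x₀`, for piecewise
continuous `u` and `w`: it is continuous, and satisfies the differential equation at every time at
which both inputs are continuous (with a one-sided derivative at time `0`). -/
def IsSolution {n m p : ℕ} (A : Matrix (Fin n) (Fin n) ℝ) (B : Matrix (Fin n) (Fin m) ℝ)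
    (C : Matrix (Fin n) (Fin p) ℝ) (x₀ : Fin n → ℝ) (u : ℝ → (Fin m → ℝ)) (w : ℝ → (Fin p → ℝ))
    (x : ℝ → (Fin n → ℝ)) : Prop :=
  x 0 = x₀ ∧ ContinuousOn x (Set.Ici 0) ∧
  ∀ t : ℝ, 0 ≤ t → ContinuousWithinAt u (Set.Ici 0) t → ContinuousWithinAt w (Set.Ici 0) t →
    HasDerivWithinAt x (A.mulVec (x t) + B.mulVec (u t) + C.mulVec (w t)) (Set.Ici 0) t

/-- `xgoal` is resiliently reachable from `x₀`: for every undesirable input `w` there are a time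
`T > 0` and a control `u` such that the solution exists, is unique, and satisfies
`x(T) = xgoal`. -/
def IsResilientlyReachable {n m p : ℕ} (A : Matrix (Fin n) (Fin n) ℝ)
    (B : Matrix (Fin n) (Fin m) ℝ) (C : Matrix (Fin n) (Fin p) ℝ)
    (U : Set (Fin m → ℝ)) (W : Set (Fin p → ℝ)) (x₀ xgoal : Fin n → ℝ) : Prop :=
  ∀ w : ℝ → (Fin p → ℝ), IsAdmissibleSignal W w →
    ∃ T : ℝ, 0 < T ∧ ∃ u : ℝ → (Fin m → ℝ), IsAdmissibleSignal U u ∧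
      ∃ x : ℝ → (Fin n → ℝ), IsSolution A B C x₀ u w x ∧
        (∀ y : ℝ → (Fin n → ℝ), IsSolution A B C x₀ u w y → Set.EqOn y x (Set.Ici 0)) ∧
        x T = xgoal

/-- The system `x' = A x + B u + C w`, `u ∈ U`, `w ∈ W`, is resilient (to the loss of the
actuators corresponding to `C`). -/
def IsResilient {n m p : ℕ} (A : Matrix (Fin n) (Fin n) ℝ)
    (B : Matrix (Fin n) (Fin m) ℝ) (C : Matrix (Fin n) (Fin p) ℝ)
    (U : Set (Fin m → ℝ)) (W : Set (Fin p → ℝ)) : Prop :=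
  ∀ xgoal x₀ : Fin n → ℝ, IsResilientlyReachable A B C U W x₀ xgoal

/-! A small ball around 0 lies in the dual input set, so it suffices to steer `x' = A x + z` with a
small continuous `z`, then solve `B u = z - C w` with `u` continuous in `(z, w)`; such a `u`
inherits piecewise continuity from `w`.

Steering: Cayley–Hamilton gives `∏ (1 - e^{hμ} e^{-hA}) = 0` for every `h`. As the `μ` are
imaginary, expanding writes the identity as a combination of positive powers of `e^{-hA}` with
coefficients bounded by 1 (`eq_sum_smul_exp_of_re_eq_zero`). Averaging over a long range of `h`
gives `v = ∫₀ᵀ ζ(s) e^{-sA} v ds` with `ζ` uniformly small (`exists_small_weight_integral_smul_eq`).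
Thus the input `-ζ x₀` cancels the initial state, and a time-reversed analogue creates the goal.

Selection: on the box of pairs `(z, w)`, multilinear interpolation of solutions chosen at the
vertices is continuous and, by linearity and convexity, remains a solution in `U`
(`exists_continuous_selection`). -/

/-! ### Exponential form of Cayley–Hamilton. -/

theorem exists_exp_sub_one_eq_mul {𝔸 : Type*} [NormedRing 𝔸] [NormedAlgebra ℂ 𝔸] [CompleteSpace 𝔸]
    (a : 𝔸) : ∃ b : 𝔸, NormedSpace.exp a - 1 = a * b ∧ ∀ y, Commute y a → Commute y b := by
  have hb : Summable fun n : ℕ => ((n + 1).factorial⁻¹ : ℂ) • a ^ n := by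
    refine .of_norm_bounded_eventually (Real.summable_pow_div_factorial ‖a‖) ?_
    filter_upwards [Filter.eventually_cofinite_ne 0] with n hn
    rw [norm_smul, mul_comm, norm_inv, RCLike.norm_natCast, ← div_eq_mul_inv]
    gcongr
    · exact norm_pow_le' _ (pos_iff_ne_zero.mpr hn)
    · exact n.le_succ
  refine ⟨∑' n : ℕ, ((n + 1).factorial⁻¹ : ℂ) • a ^ n, ?_, fun y hy =>
    Commute.tsum_right _ fun n => (hy.pow_right n).smul_right _⟩
  have h₀ : (∑' n : ℕ, ((n + 1).factorial⁻¹ : ℂ) • a ^ (n + 1)) =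
      a * ∑' n : ℕ, ((n + 1).factorial⁻¹ : ℂ) • a ^ n := by
    simpa only [mul_smul_comm, pow_succ'] using hb.tsum_mul_left a
  rw [sub_eq_iff_eq_add', NormedSpace.exp_eq_tsum ℂ, ← h₀]
  simpa using (NormedSpace.expSeries_summable' (𝕂 := ℂ) a).tsum_eq_zero_add

/-- Each factor equals `1 - exp (-h (a - μ))`, a multiple of `a - μ`; the cofactors commute past the
other linear factors, so the vanishing product splits off. -/
theorem list_prod_one_sub_exp_eq_zero {𝔸 : Type*} [NormedRing 𝔸] [NormedAlgebra ℂ 𝔸]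
    [CompleteSpace 𝔸] (a : 𝔸) (l : List ℂ) (hl : (l.map fun μ => a - algebraMap ℂ 𝔸 μ).prod = 0)
    (h : ℂ) : (l.map fun μ => 1 - Complex.exp (h * μ) • NormedSpace.exp ((-h) • a)).prod = 0 := by
  let +nondep : NormedAlgebra ℚ 𝔸 := .restrictScalars ℚ ℂ 𝔸
  have key : ∀ l : List ℂ, ∃ g : 𝔸,
      (l.map fun μ => 1 - Complex.exp (h * μ) • NormedSpace.exp ((-h) • a)).prod =
        (l.map fun μ => a - algebraMap ℂ 𝔸 μ).prod * g := by
    intro l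
    induction l with
    | nil => exact ⟨1, by simp⟩
    | cons μ l ih =>
      obtain ⟨g, hg⟩ := ih
      obtain ⟨b, hb, hcomm⟩ := exists_exp_sub_one_eq_mul ((-h) • (a - algebraMap ℂ 𝔸 μ))
      have hca : ∀ ν : ℂ, Commute (a - algebraMap ℂ 𝔸 ν) a := fun ν =>
        (Commute.refl a).sub_left (Algebra.commutes ν a)
      have hcb : Commute (l.map fun μ => a - algebraMap ℂ 𝔸 μ).prod b := by
        refine Commute.list_prod_left _ _ fun x hx => ?_
        obtain ⟨ν, -, rfl⟩ := List.mem_map.1 hx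
        exact hcomm _ (((hca ν).sub_right (Algebra.commutes μ _).symm).smul_right _)
      have hexp : Complex.exp (h * μ) • NormedSpace.exp ((-h) • a) =
          NormedSpace.exp ((-h) • (a - algebraMap ℂ 𝔸 μ)) := by
        have : (-h) • (a - algebraMap ℂ 𝔸 μ) = algebraMap ℂ 𝔸 (h * μ) + (-h) • a := by
          rw [smul_sub, map_mul, neg_smul, neg_smul, ← Algebra.smul_def]
          abel
        rw [this, NormedSpace.exp_add_of_commute (Algebra.commutes _ _),
          ← NormedSpace.algebraMap_exp_comm, ← Algebra.smul_def, Complex.exp_eq_exp_ℂ]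
      refine ⟨h • (b * g), ?_⟩
      rw [List.map_cons, List.prod_cons, hg, List.map_cons, List.prod_cons, hexp,
        ← neg_sub, hb, smul_mul_assoc, neg_smul, neg_neg, smul_mul_assoc, mul_smul_comm,
        mul_assoc, mul_assoc, ← mul_assoc b, ← hcb.eq, mul_assoc]
  obtain ⟨g, hg⟩ := key l
  rw [hg, hl, zero_mul]

theorem list_prod_one_sub_smul_eq {𝔸 : Type*} [Ring 𝔸] [Algebra ℂ 𝔸] (l : List ℂ)
    (hl : ∀ μ ∈ l, μ.re = 0) :
    ∃ (ι : Type) (_ : Fintype ι) (d : ι → ℕ) (c : ι → ℝ → ℂ),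
      (∀ i, Continuous (c i)) ∧ (∀ i h, ‖c i h‖ ≤ 1) ∧ ∀ (h : ℝ) (M : 𝔸),
        (l.map fun μ => 1 - Complex.exp (h * μ) • M).prod = 1 - ∑ i, c i h • M ^ (d i + 1) := by
  induction l with
  | nil => exact ⟨Empty, inferInstance, Empty.elim, Empty.elim, by simp, by simp, by simp⟩
  | cons μ l ih =>
    obtain ⟨ι, _, d, c, hc, hc1, H⟩ := ih fun ν hν => hl ν (List.mem_cons_of_mem _ hν)
    have hμ : ∀ h : ℝ, ‖Complex.exp (h * μ)‖ = 1 := fun h => by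
      simp [Complex.norm_exp, hl μ List.mem_cons_self]
    -- Multiplying by the new factor yields its own linear term, the old terms, and the old terms
    -- raised by one degree.
    refine ⟨Option (ι ⊕ ι), inferInstance,
      fun o => o.elim 0 (Sum.elim d fun i => d i + 1),
      fun o h => o.elim (Complex.exp (h * μ))
        (Sum.elim (fun i => c i h) fun i => -(Complex.exp (h * μ) * c i h)), ?_, ?_, ?_⟩
    · rintro (_ | i | i)
      · simp only [Option.elim]; fun_prop
      · exact hc i
      · have := hc i
        simp only [Option.elim, Sum.elim_inr]; fun_prop
    · rintro (_ | i | i) h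
      · exact (hμ h).le
      · exact hc1 i h
      · simpa [hμ h] using hc1 i h
    · intro h M
      rw [List.map_cons, List.prod_cons, H h M, Fintype.sum_option, Fintype.sum_sum_type]
      simp only [Option.elim, Sum.elim_inl, Sum.elim_inr, zero_add, pow_one, sub_mul, mul_sub,
        one_mul, mul_one, Finset.mul_sum, neg_smul, Finset.sum_neg_distrib, smul_mul_smul_comm,
        ← pow_succ', Finset.sum_sub_distrib]
      abel

section
attribute [local instance] Matrix.linftyOpNormedRing Matrix.linftyOpNormedAlgebra

theorem eq_sum_smul_exp_of_re_eq_zero {n : ℕ} (A : Matrix (Fin n) (Fin n) ℝ)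
    (hA : ∀ μ ∈ eigenvalueSet A, μ.re = 0) :
    ∃ (ι : Type) (_ : Fintype ι) (d : ι → ℕ) (c : ι → ℝ → ℝ),
      (∀ i, Continuous (c i)) ∧ (∀ i h, |c i h| ≤ 1) ∧ ∀ (h : ℝ) (v : Fin n → ℝ),
        v = ∑ i, c i h •
          NormedSpace.exp (-((d i + 1 : ℝ) * h) • (Matrix.toLin' A).toContinuousLinearMap) v := by
  set A' : Matrix (Fin n) (Fin n) ℂ := A.map Complex.ofReal with hA'
  set L := (Matrix.toLin' A).toContinuousLinearMap with hL
  set l : List ℂ := A'.charpoly.roots.toList with hl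
  have hre : ∀ μ ∈ l, μ.re = 0 := by
    intro μ hμ
    apply hA
    rw [hl, Multiset.mem_toList, Polynomial.mem_roots'] at hμ
    change Module.End.HasEigenvalue _ _
    rw [Module.End.hasEigenvalue_iff_isRoot_charpoly, Matrix.charpoly_toLin']
    exact hμ.2
  have hprod : (l.map fun μ => A' - algebraMap ℂ _ μ).prod = 0 := by
    have h1 := Matrix.aeval_self_charpoly A'
    rw [(IsAlgClosed.splits A'.charpoly).eq_prod_roots_of_monic (Matrix.charpoly_monic A'),
      ← Multiset.coe_toList A'.charpoly.roots, Multiset.map_coe, Multiset.prod_coe,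
      map_list_prod, List.map_map] at h1
    simpa [Function.comp_def] using h1
  obtain ⟨ι, _, d, c, hc, hc1, H⟩ := list_prod_one_sub_smul_eq
    (𝔸 := Matrix (Fin n) (Fin n) ℂ) l hre
  refine ⟨ι, inferInstance, d, fun i h => (c i h).re,
    fun i => Complex.continuous_re.comp (hc i),
    fun i h => (Complex.abs_re_le_norm _).trans (hc1 i h), fun h v => ?_⟩
  have h1 : 1 = ∑ i, c i h • (NormedSpace.exp ((-(h : ℂ)) • A')) ^ (d i + 1) :=
    sub_eq_zero.1 ((H h _).symm.trans (list_prod_one_sub_exp_eq_zero A' l hprod h))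
  let φ : ((Fin n → ℝ) →L[ℝ] (Fin n → ℝ)) →ₐ[ℝ] Matrix (Fin n) (Fin n) ℝ :=
    (LinearMap.toMatrixAlgEquiv' : _ ≃ₐ[ℝ] Matrix (Fin n) (Fin n) ℝ).toAlgHom.comp
      (Module.End.toContinuousLinearMap (𝕜 := ℝ) (Fin n → ℝ)).symm.toAlgHom
  let ψ : ((Fin n → ℝ) →L[ℝ] (Fin n → ℝ)) →ₐ[ℝ] Matrix (Fin n) (Fin n) ℂ :=
    Complex.ofRealAm.mapMatrix.comp φ
  have hφ : ∀ f v, (φ f).mulVec v = f v := fun f v => LinearMap.toMatrix'_mulVec _ _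
  have hφL : φ L = A := LinearMap.toMatrix'_toLin' A
  have hψL : ψ L = A' := congrArg (fun M => M.map Complex.ofReal) hφL
  have hψc : Continuous ψ := ψ.toLinearMap.continuous_of_finiteDimensional
  let +nondep : NormedAlgebra ℚ (Matrix (Fin n) (Fin n) ℂ) := .restrictScalars ℚ ℂ _
  let +nondep : NormedAlgebra ℚ ((Fin n → ℝ) →L[ℝ] (Fin n → ℝ)) := .restrictScalars ℚ ℝ _
  have hexp : ∀ i, (NormedSpace.exp ((-(h : ℂ)) • A')) ^ (d i + 1) =
      (φ (NormedSpace.exp (-((d i + 1 : ℝ) * h) • L))).map Complex.ofReal := by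
    intro i
    have e1 : (NormedSpace.exp ((-(h : ℂ)) • A')) ^ (d i + 1) =
        NormedSpace.exp ((d i + 1) • ((-(h : ℂ)) • A')) :=
      (NormedSpace.exp_nsmul (d i + 1) ((-(h : ℂ)) • A')).symm
    have e2 : ψ (NormedSpace.exp (-((d i + 1 : ℝ) * h) • L)) =
        NormedSpace.exp (ψ (-((d i + 1 : ℝ) * h) • L)) :=
      NormedSpace.map_exp ψ hψc _
    refine e1.trans (Eq.trans (congrArg _ ?_) e2.symm)
    rw [map_smul, hψL]
    ext j k
    simp
    ring
  have h2 : (1 : Matrix (Fin n) (Fin n) ℝ) =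
      ∑ i, (c i h).re • φ (NormedSpace.exp (-((d i + 1 : ℝ) * h) • L)) := by
    ext j k
    have := congrArg Complex.re (congrFun (congrFun h1 j) k)
    simp only [hexp, Matrix.sum_apply, Matrix.smul_apply, Matrix.map_apply, Complex.re_sum,
      smul_eq_mul, Complex.re_mul_ofReal] at this
    -- The exponentials of `A` are real, so taking real parts only affects the coefficients.
    simp only [Matrix.sum_apply, Matrix.smul_apply, smul_eq_mul]
    rw [← this, Matrix.one_apply, Matrix.one_apply]
    split_ifs <;> simp
  calc v = (1 : Matrix (Fin n) (Fin n) ℝ).mulVec v := (Matrix.one_mulVec v).symm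
    _ = _ := by
      rw [h2, Matrix.sum_mulVec]
      simp only [Matrix.smul_mulVec, hφ]
end

/-! ### Averaging and steering with small inputs. -/

theorem exists_small_weight_integral_smul_eq {E : Type*} [NormedAddCommGroup E] [NormedSpace ℝ E]
    [CompleteSpace E] {ι : Type*} [Fintype ι] (d : ι → ℕ) (c : ι → ℝ → ℝ)
    (hc : ∀ i, Continuous (c i)) (hc1 : ∀ i h, |c i h| ≤ 1) {ε : ℝ} (hε : 0 < ε) :
    ∃ T₀ : ℝ, ∀ T, T₀ ≤ T → ∃ ζ : ℝ → ℝ, Continuous ζ ∧ (∀ s, |ζ s| ≤ ε) ∧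
      ∀ (F : ℝ → E) (v : E), Continuous F → (∀ h, v = ∑ i, c i h • F ((d i + 1) * h)) →
        ∫ s in (0 : ℝ)..T, ζ s • F s = v := by
  -- `D` dominates every `d i + 1`, so with `H = T / D` each substitution `s = (d i + 1) h` maps
  -- `[0, H]` into `[0, T]`.
  set D : ℝ := 1 + ∑ i, (d i + 1 : ℝ) with hD
  have hDpos : 0 < D := by positivity
  set N : ℝ := (Fintype.card ι : ℝ) with hN
  refine ⟨D * (2 * (N + 1) / ε), fun T hT => ?_⟩
  set H : ℝ := T / D with hH
  have hHT : 2 * (N + 1) / ε ≤ H := by rw [hH, le_div_iff₀ hDpos, mul_comm]; exact hT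
  have hNpos : 0 ≤ N := by positivity
  have hHpos : 0 < H := lt_of_lt_of_le (by positivity) hHT
  -- A tent of mass 1 on `[0, H]` and height `2 / H`; vanishing at `H` keeps `ζ` continuous.
  set ρ : ℝ → ℝ := fun h => 2 / H ^ 2 * max (H - |h|) 0 with hρ
  have hρc : Continuous ρ := by fun_prop
  have hρ0 : ∀ h, 0 ≤ ρ h := fun h => by positivity
  have hρ1 : ∀ h, ρ h ≤ 2 / H := fun h => by
    have : max (H - |h|) 0 ≤ H := max_le (by linarith [abs_nonneg h]) hHpos.le
    calc ρ h ≤ 2 / H ^ 2 * H := by simp only [hρ]; gcongr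
      _ = 2 / H := by field_simp
  have hρz : ∀ h, H ≤ h → ρ h = 0 := fun h hh => by
    simp only [hρ]
    rw [abs_of_nonneg (hHpos.le.trans hh), max_eq_right (by linarith), mul_zero]
  have hρint : ∫ h in (0 : ℝ)..H, ρ h = 1 := by
    have : ∫ h in (0 : ℝ)..H, ρ h = ∫ h in (0 : ℝ)..H, (2 / H ^ 2 * (H - h)) := by
      refine intervalIntegral.integral_congr fun h hh => ?_
      rw [uIcc_of_le hHpos.le] at hh
      simp only [hρ]
      rw [abs_of_nonneg hh.1, max_eq_left (by linarith [hh.2])]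
    rw [this, intervalIntegral.integral_const_mul, intervalIntegral.integral_sub (by simp) (by simp)]
    simp
    field_simp
    ring
  refine ⟨fun s => ∑ i, ((d i + 1 : ℝ)⁻¹ * (ρ (s / (d i + 1)) * c i (s / (d i + 1)))), ?_, ?_, ?_⟩
  · fun_prop
  · intro s
    calc |∑ i, ((d i + 1 : ℝ)⁻¹ * (ρ (s / (d i + 1)) * c i (s / (d i + 1))))|
        ≤ ∑ i, |((d i + 1 : ℝ)⁻¹ * (ρ (s / (d i + 1)) * c i (s / (d i + 1))))| :=
          Finset.abs_sum_le_sum_abs _ _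
      _ ≤ ∑ _i : ι, 1 * (2 / H * 1) := by
          refine Finset.sum_le_sum fun i _ => ?_
          rw [abs_mul, abs_mul, abs_of_nonneg (hρ0 _), abs_of_nonneg (by positivity)]
          gcongr
          · exact inv_le_one_of_one_le₀ (by linarith [(d i).cast_nonneg (α := ℝ)])
          · exact hρ1 _
          · exact hc1 _ _
      _ = N * 2 / H := by simp [hN]; ring
      _ ≤ ε := by
          rw [div_le_iff₀ hHpos]
          rw [div_le_iff₀ hε] at hHT
          linarith
  · intro F v hF hv
    have hterm : ∀ i, ∫ s in (0 : ℝ)..T,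
        ((d i + 1 : ℝ)⁻¹ * (ρ (s / (d i + 1)) * c i (s / (d i + 1)))) • F s =
        ∫ h in (0 : ℝ)..H, ρ h • c i h • F ((d i + 1) * h) := by
      intro i
      have hd : (0 : ℝ) < d i + 1 := by positivity
      have hdD : (d i + 1 : ℝ) ≤ D := by
        have := Finset.single_le_sum (f := fun i => (d i + 1 : ℝ)) (fun j _ => by positivity)
          (Finset.mem_univ i)
        linarith
      have hHle : H ≤ T / (d i + 1) := by
        rw [le_div_iff₀ hd]
        calc H * (d i + 1) ≤ H * D := by gcongr
          _ = T := by rw [hH]; field_simp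
      set g : ℝ → E := fun h => ρ h • c i h • F ((d i + 1) * h) with hg
      have hgc : Continuous g := by have := hc i; fun_prop
      have e1 : ∀ s, ((d i + 1 : ℝ)⁻¹ * (ρ (s / (d i + 1)) * c i (s / (d i + 1)))) • F s =
          (d i + 1 : ℝ)⁻¹ • g (s / (d i + 1)) := fun s => by
        simp only [hg, smul_smul]
        rw [mul_div_cancel₀ _ hd.ne', mul_assoc]
      simp only [e1]
      rw [intervalIntegral.integral_smul, intervalIntegral.integral_comp_div _ hd.ne',
        smul_smul, inv_mul_cancel₀ hd.ne', one_smul, zero_div,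
        ← intervalIntegral.integral_add_adjacent_intervals (hgc.intervalIntegrable 0 H)
          (hgc.intervalIntegrable H _)]
      rw [intervalIntegral.integral_congr (g := fun _ => (0 : E)) (a := H),
        intervalIntegral.integral_zero, add_zero]
      intro h hh
      rw [uIcc_of_le hHle] at hh
      simp [hg, hρz h hh.1]
    simp only [Finset.sum_smul]
    rw [intervalIntegral.integral_finsetSum]
    · simp only [hterm]
      rw [← intervalIntegral.integral_finsetSum]
      · simp only [← Finset.smul_sum, ← hv]
        rw [intervalIntegral.integral_smul_const, hρint, one_smul]
      · intro i _
        have := hc i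
        exact Continuous.intervalIntegrable (by fun_prop) _ _
    · intro i _
      have := hc i
      exact Continuous.intervalIntegrable (by fun_prop) _ _

theorem hasDerivAt_exp_smul_apply {E : Type*} [NormedAddCommGroup E] [NormedSpace ℝ E]
    [CompleteSpace E] (L : E →L[ℝ] E) {y : ℝ → E} {y' : E} {t : ℝ} (hy : HasDerivAt y y' t) :
    HasDerivAt (fun s => NormedSpace.exp (s • L) (y s))
      (L (NormedSpace.exp (t • L) (y t)) + NormedSpace.exp (t • L) y') t :=
  (hasDerivAt_exp_smul_const' (𝕂 := ℝ) L t).clm_apply hy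

theorem exp_smul_apply_exp_smul_apply {E : Type*} [NormedAddCommGroup E] [NormedSpace ℝ E]
    [CompleteSpace E] (L : E →L[ℝ] E) (s t : ℝ) (v : E) :
    NormedSpace.exp (s • L) (NormedSpace.exp (t • L) v) = NormedSpace.exp ((s + t) • L) v := by
  let +nondep : NormedAlgebra ℚ (E →L[ℝ] E) := .restrictScalars ℚ ℝ _
  rw [add_smul, NormedSpace.exp_add_of_commute (((Commute.refl L).smul_left s).smul_right t)]
  rfl

theorem continuous_exp_smul_apply {E : Type*} [NormedAddCommGroup E] [NormedSpace ℝ E]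
    [CompleteSpace E] (L : E →L[ℝ] E) (v : E) :
    Continuous fun s : ℝ => NormedSpace.exp (s • L) v :=
  continuous_iff_continuousAt.2 fun t =>
    (hasDerivAt_exp_smul_apply L (hasDerivAt_const t v)).continuousAt

theorem exists_steering_of_re_eq_zero {n : ℕ} (A : Matrix (Fin n) (Fin n) ℝ)
    (hA : ∀ μ ∈ eigenvalueSet A, μ.re = 0) {δ : ℝ} (hδ : 0 < δ) (x₀ xgoal : Fin n → ℝ) :
    ∃ T : ℝ, 0 < T ∧ ∃ z x : ℝ → Fin n → ℝ, Continuous z ∧ (∀ t, ‖z t‖ ≤ δ) ∧ x 0 = x₀ ∧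
      x T = xgoal ∧ ∀ t, HasDerivAt x (A.mulVec (x t) + z t) t := by
  obtain ⟨ι, _, d, c, hc, hc1, H⟩ := eq_sum_smul_exp_of_re_eq_zero A hA
  set L := (Matrix.toLin' A).toContinuousLinearMap with hL
  have hLA : ∀ v, L v = A.mulVec v := fun v => Matrix.toLin'_apply A v
  set ε : ℝ := δ / (‖x₀‖ + ‖xgoal‖ + 1) with hε
  have hεpos : 0 < ε := by positivity
  obtain ⟨T₁, h₁⟩ := exists_small_weight_integral_smul_eq (E := Fin n → ℝ) d c hc hc1 hεpos
  -- The relation at `-h` involves the forward flow, as needed to reach the goal.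
  obtain ⟨T₂, h₂⟩ := exists_small_weight_integral_smul_eq (E := Fin n → ℝ) d
    (fun i h => c i (-h)) (fun i => (hc i).comp continuous_neg) (fun i h => hc1 i _) hεpos
  set T : ℝ := max (max T₁ T₂) 1 with hT
  have hTpos : 0 < T := lt_of_lt_of_le one_pos (le_max_right _ _)
  obtain ⟨ζ₁, hζ₁, hζ₁b, hi₁⟩ := h₁ T ((le_max_left _ _).trans (le_max_left _ _))
  obtain ⟨ζ₂, hζ₂, hζ₂b, hi₂⟩ := h₂ T ((le_max_right _ _).trans (le_max_left _ _))
  have hi₁ : ∫ s in (0 : ℝ)..T, ζ₁ s • NormedSpace.exp ((-s) • L) x₀ = x₀ :=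
    hi₁ (fun s => NormedSpace.exp ((-s) • L) x₀) x₀
      ((continuous_exp_smul_apply L x₀).comp continuous_neg) (fun h => H h x₀)
  have hi₂ : ∫ s in (0 : ℝ)..T, ζ₂ s • NormedSpace.exp (s • L) xgoal = xgoal :=
    hi₂ (fun s => NormedSpace.exp (s • L) xgoal) xgoal (continuous_exp_smul_apply L xgoal)
      (fun h => by simpa using H (-h) xgoal)
  set z : ℝ → Fin n → ℝ := fun t => ζ₂ (T - t) • xgoal - ζ₁ t • x₀ with hz
  have hzc : Continuous z := by fun_prop
  set G : ℝ → Fin n → ℝ := fun s => NormedSpace.exp ((-s) • L) (z s) with hG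
  have hGeq : ∀ s, G s = ζ₂ (T - s) • NormedSpace.exp ((-s) • L) xgoal -
      ζ₁ s • NormedSpace.exp ((-s) • L) x₀ := fun s => by
    simp only [hG, hz, map_sub, map_smul]
  have hc₁ : Continuous fun s : ℝ => ζ₁ s • NormedSpace.exp ((-s) • L) x₀ :=
    hζ₁.smul ((continuous_exp_smul_apply L x₀).comp continuous_neg)
  have hc₂ : Continuous fun s : ℝ => ζ₂ (T - s) • NormedSpace.exp ((-s) • L) xgoal :=
    (hζ₂.comp (by fun_prop)).smul ((continuous_exp_smul_apply L xgoal).comp continuous_neg)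
  have hGc : Continuous G := by
    rw [funext hGeq]
    exact hc₂.sub hc₁
  refine ⟨T, hTpos, z, fun t => NormedSpace.exp (t • L) (x₀ + ∫ s in (0 : ℝ)..t, G s), hzc,
    fun t => ?_, ?_, ?_, fun t => ?_⟩
  · calc ‖z t‖ ≤ ‖ζ₂ (T - t) • xgoal‖ + ‖ζ₁ t • x₀‖ := norm_sub_le _ _
      _ ≤ ε * ‖xgoal‖ + ε * ‖x₀‖ := by
        rw [norm_smul, norm_smul]
        gcongr
        · exact hζ₂b _
        · exact hζ₁b _
      _ ≤ ε * (‖x₀‖ + ‖xgoal‖ + 1) := by nlinarith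
      _ = δ := by rw [hε]; field_simp
  · simp [NormedSpace.exp_zero]
  · simp only [hGeq]
    rw [intervalIntegral.integral_sub (hc₂.intervalIntegrable _ _) (hc₁.intervalIntegrable _ _),
      hi₁, add_sub_cancel, ← ContinuousLinearMap.intervalIntegral_comp_comm _
      (hc₂.intervalIntegrable _ _)]
    simp only [map_smul, exp_smul_apply_exp_smul_apply, ← sub_eq_add_neg]
    rw [intervalIntegral.integral_comp_sub_left
      (fun s => ζ₂ s • NormedSpace.exp (s • L) xgoal) T, sub_self, sub_zero, hi₂]
  · have := hasDerivAt_exp_smul_apply L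
      ((hGc.integral_hasStrictDerivAt 0 t).hasDerivAt.const_add x₀)
    have hzt : NormedSpace.exp (t • L) (G t) = z t := by
      simp [hG, exp_smul_apply_exp_smul_apply, NormedSpace.exp_zero]
    rwa [hLA, hzt] at this

/-- The function `e^{-tL} (y - x)` is continuous with zero derivative off a countable set, hence
constant. -/
theorem eqOn_Ici_of_hasDerivAt_off_countable {E : Type*} [NormedAddCommGroup E] [NormedSpace ℝ E]
    [CompleteSpace E] (L : E →L[ℝ] E) {x y : ℝ → E} {f : ℝ → E} (hx : ContinuousOn x (Ici 0))
    (hy : ContinuousOn y (Ici 0)) (h0 : y 0 = x 0) {s : ℝ → Set ℝ} (hs : ∀ T, (s T).Countable)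
    (hx' : ∀ T, ∀ t ∈ Ioo 0 T \ s T, HasDerivAt x (L (x t) + f t) t)
    (hy' : ∀ T, ∀ t ∈ Ioo 0 T \ s T, HasDerivAt y (L (y t) + f t) t) : EqOn y x (Ici 0) := by
  intro T hT
  have hT : (0 : ℝ) ≤ T := hT
  set g : ℝ → E := fun t => NormedSpace.exp (t • (-L)) (y t - x t) with hg
  have hd : ∀ t ∈ Ioo 0 T \ s T, HasDerivAt g ((fun _ => 0) t) t := by
    intro t ht
    have h2 := hasDerivAt_exp_smul_apply (-L) ((hy' T t ht).sub (hx' T t ht))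
    have hcomm : Commute (-L) (NormedSpace.exp (t • (-L))) := by
      let +nondep : NormedAlgebra ℚ (E →L[ℝ] E) := .restrictScalars ℚ ℝ _
      exact ((Commute.refl (-L)).smul_right t).exp_right
    have e1 : (-L) (NormedSpace.exp (t • (-L)) (y t - x t)) =
        NormedSpace.exp (t • (-L)) ((-L) (y t - x t)) :=
      congrArg (fun M : E →L[ℝ] E => M (y t - x t)) hcomm.eq
    refine HasDerivAt.congr_deriv (f := g) h2 ?_
    simp only [Pi.sub_apply]
    rw [e1, ← map_add]
    simp
  have hgc : ContinuousOn g (Icc 0 T) := by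
    have h1 : Continuous fun t : ℝ => NormedSpace.exp (t • (-L)) :=
      continuous_iff_continuousAt.2 fun t =>
        (hasDerivAt_exp_smul_const' (𝕂 := ℝ) (-L) t).continuousAt
    exact h1.continuousOn.clm_apply ((hy.sub hx).mono Icc_subset_Ici_self)
  have h3 := MeasureTheory.integral_eq_of_hasDerivAt_off_countable_of_le g (fun _ => 0) hT (hs T)
    hgc hd (by simp)
  rw [intervalIntegral.integral_zero, eq_comm, sub_eq_zero] at h3
  have h4 : g T = 0 := by rw [h3]; simp [hg, h0]
  have h5 := congrArg (fun v => NormedSpace.exp (T • L) v) h4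
  simp only [hg] at h5
  rw [smul_neg, ← neg_smul, exp_smul_apply_exp_smul_apply] at h5
  simpa [NormedSpace.exp_zero, sub_eq_zero] using h5

/-! ### Continuous selection on a box. -/

/-- The weights are products of one-dimensional barycentric coordinates; the sums over vertices
factor coordinatewise. -/
theorem exists_continuous_vertex_weights {ι : Type*} [Fintype ι] [DecidableEq ι] (lo hi : ι → ℝ) :
    ∃ q : (ι → Bool) → (ι → ℝ) → ℝ, (∀ b, Continuous (q b)) ∧
      (∀ b, ∀ s ∈ Icc lo hi, 0 ≤ q b s) ∧ (∀ s, ∑ b, q b s = 1) ∧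
      ∀ s ∈ Icc lo hi, ∑ b, q b s • (fun i => bif b i then hi i else lo i) = s := by
  set θ : ι → (ι → ℝ) → ℝ := fun i s => (s i - lo i) / (hi i - lo i) with hθ
  have hsum : ∀ g : ι → Bool → ℝ, ∑ b : ι → Bool, ∏ i, g i (b i) = ∏ i, (g i true + g i false) := by
    intro g
    have := Finset.prod_univ_sum (fun _ : ι => (Finset.univ : Finset Bool)) g
    rw [Fintype.piFinset_univ] at this
    simp [← this]
  refine ⟨fun b s => ∏ i, bif b i then θ i s else 1 - θ i s, fun b => ?_, fun b s hs => ?_,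
    fun s => ?_, fun s hs => ?_⟩
  · refine continuous_finsetProd _ fun i _ => ?_
    cases b i <;> simp only [hθ, cond_true, cond_false] <;> fun_prop
  · refine Finset.prod_nonneg fun i _ => ?_
    have h1 := hs.1 i
    have h2 := hs.2 i
    have h3 : θ i s ≤ 1 := div_le_one_of_le₀ (by linarith) (by linarith)
    have h4 : 0 ≤ θ i s := div_nonneg (by linarith) (by linarith)
    cases b i <;> simp only [cond_true, cond_false] <;> linarith
  · rw [hsum fun i a => bif a then θ i s else 1 - θ i s]
    simp
  · ext j
    have h1 := hsum fun i a => (bif a then θ i s else 1 - θ i s) *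
      (if i = j then (bif a then hi i else lo i) else 1)
    have h2 : ∀ b : ι → Bool, ∏ i, (bif b i then θ i s else 1 - θ i s) *
        (if i = j then (bif b i then hi i else lo i) else 1) =
        (∏ i, bif b i then θ i s else 1 - θ i s) * (bif b j then hi j else lo j) := by
      intro b
      rw [Finset.prod_mul_distrib, Finset.prod_ite_eq' Finset.univ j]
      simp
    simp only [h2] at h1
    simp only [Finset.sum_apply, Pi.smul_apply, smul_eq_mul]
    rw [h1, Finset.prod_eq_single j]
    · simp only [cond_true, cond_false, if_true, hθ]
      -- On a degenerate edge `θ` is 0 by the division convention, and `s j = lo j = hi j`.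
      rcases eq_or_ne (hi j - lo j) 0 with h | h
      · have h3 := hs.1 j
        have h4 := hs.2 j
        rw [h]
        simp
        linarith
      · field_simp
        ring
    · intro i _ hij
      simp [hij]
    · simp

theorem exists_continuous_selection {ι E F : Type*} [Fintype ι] [AddCommGroup E] [Module ℝ E]
    [TopologicalSpace E] [ContinuousAdd E] [ContinuousSMul ℝ E] [AddCommGroup F] [Module ℝ F]
    (P : (ι → ℝ) →ₗ[ℝ] F) (Q : E →ₗ[ℝ] F) {U : Set E} (hU : Convex ℝ U) {lo hi : ι → ℝ}
    (h : ∀ s ∈ Icc lo hi, ∃ u ∈ U, Q u = P s) :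
    ∃ φ : (ι → ℝ) → E, Continuous φ ∧ ∀ s ∈ Icc lo hi, φ s ∈ U ∧ Q (φ s) = P s := by
  classical
  by_cases hle : lo ≤ hi
  · obtain ⟨q, hqc, hq0, hq1, hqs⟩ := exists_continuous_vertex_weights lo hi
    have hv : ∀ b : ι → Bool, (fun i => bif b i then hi i else lo i) ∈ Icc lo hi := fun b =>
      ⟨fun i => by cases hb : b i <;> simp [hb, hle i], fun i => by
        cases hb : b i <;> simp [hb, hle i]⟩
    choose u huU hu using fun b : ι → Bool => h _ (hv b)
    refine ⟨fun s => ∑ b, q b s • u b, ?_, fun s hs =>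
      ⟨hU.sum_mem (fun b _ => hq0 b s hs) (hq1 s) fun b _ => huU b, ?_⟩⟩
    · exact continuous_finsetSum _ fun b _ => (hqc b).smul continuous_const
    · simp only [map_sum, map_smul, hu]
      simp only [← map_smul, ← map_sum, hqs s hs]
  · exact ⟨fun _ => 0, continuous_const, fun s hs => absurd (hs.1.trans hs.2) hle⟩

/-! ### Admissibility, uniqueness and assembly. -/

theorem IsPiecewiseContinuous.continuous_comp₂ {k l n : ℕ} {w : ℝ → Fin k → ℝ}
    (hw : IsPiecewiseContinuous w) {z : ℝ → Fin n → ℝ} (hz : Continuous z)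
    {φ : (Fin n → ℝ) → (Fin k → ℝ) → Fin l → ℝ} (hφ : Continuous (Function.uncurry φ)) :
    IsPiecewiseContinuous fun t => φ (z t) (w t) := by
  obtain ⟨h1, h2, h3⟩ := hw
  refine ⟨fun T => (h1 T).subset fun t ht => ⟨ht.1, fun hc => ht.2 ?_⟩, fun t ht => ?_,
    fun t ht => ?_⟩
  · exact hφ.continuousAt.comp_continuousWithinAt (hz.continuousWithinAt.prodMk hc)
  · obtain ⟨a, ha⟩ := h2 t ht
    exact ⟨φ (z t) a, (hφ.tendsto (z t, a)).comp
      (((hz.tendsto t).mono_left nhdsWithin_le_nhds).prodMk_nhds ha)⟩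
  · obtain ⟨a, ha⟩ := h3 t ht
    exact ⟨φ (z t) a, (hφ.tendsto (z t, a)).comp
      (((hz.tendsto t).mono_left nhdsWithin_le_nhds).prodMk_nhds ha)⟩

theorem IsSolution.eqOn {n m p : ℕ} {A : Matrix (Fin n) (Fin n) ℝ}
    {B : Matrix (Fin n) (Fin m) ℝ} {C : Matrix (Fin n) (Fin p) ℝ} {x₀ : Fin n → ℝ}
    {u : ℝ → Fin m → ℝ} {w : ℝ → Fin p → ℝ} (hu : IsPiecewiseContinuous u)
    (hw : IsPiecewiseContinuous w) {x y : ℝ → Fin n → ℝ} (hx : IsSolution A B C x₀ u w x)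
    (hy : IsSolution A B C x₀ u w y) : EqOn y x (Ici 0) := by
  have key : ∀ {v : ℝ → Fin n → ℝ}, IsSolution A B C x₀ u w v → ∀ T, ∀ t ∈ Ioo 0 T \
      ({t | t ∈ Icc 0 T ∧ ¬ ContinuousWithinAt u (Ici 0) t} ∪
        {t | t ∈ Icc 0 T ∧ ¬ ContinuousWithinAt w (Ici 0) t}),
      HasDerivAt v ((Matrix.toLin' A).toContinuousLinearMap (v t) +
        (B.mulVec (u t) + C.mulVec (w t))) t := by
    intro v hv T t ht
    have h1 : ContinuousWithinAt u (Ici 0) t := by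
      by_contra h
      exact ht.2 (Or.inl ⟨Ioo_subset_Icc_self ht.1, h⟩)
    have h2 : ContinuousWithinAt w (Ici 0) t := by
      by_contra h
      exact ht.2 (Or.inr ⟨Ioo_subset_Icc_self ht.1, h⟩)
    rw [← add_assoc]
    exact (hv.2.2 t ht.1.1.le h1 h2).hasDerivAt (Ici_mem_nhds ht.1.1)
  exact eqOn_Ici_of_hasDerivAt_off_countable _ hx.2.1 hy.2.1 (hy.1.trans hx.1.symm)
    (fun T => ((hu.1 T).union (hw.1 T)).countable) (key hx) (key hy)

theorem exists_eq_Icc_of_isHyperrectangle_jointInputSet {m p : ℕ} {U : Set (Fin m → ℝ)}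
    {W : Set (Fin p → ℝ)} (h : IsHyperrectangle (jointInputSet U W)) :
    (∃ a b : Fin m → ℝ, U = Icc a b) ∧ ∃ a b : Fin p → ℝ, W = Icc a b := by
  obtain ⟨lo, hi, hle, h⟩ := h
  have hlo : lo ∈ jointInputSet U W := h ▸ left_mem_Icc.2 hle
  have hmem : ∀ u w, u ∈ U ∧ w ∈ W ↔ Sum.elim u w ∈ Icc lo hi := fun u w => by
    rw [← h]; rfl
  have hIcc : ∀ u w, Sum.elim u w ∈ Icc lo hi ↔
      u ∈ Icc (fun i => lo (.inl i)) (fun i => hi (.inl i)) ∧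
      w ∈ Icc (fun i => lo (.inr i)) (fun i => hi (.inr i)) := fun u w => by
    simp only [mem_Icc, Pi.le_def, Sum.forall, Sum.elim_inl, Sum.elim_inr]
    tauto
  refine ⟨⟨_, _, ext fun u => ⟨fun hu => ((hIcc _ _).1 ((hmem u _).1 ⟨hu, hlo.2⟩)).1,
    fun hu => ((hmem u fun i => lo (.inr i)).2 ((hIcc _ _).2 ⟨hu, fun i => le_rfl, fun i => hle _⟩)).1⟩⟩,
    ⟨_, _, ext fun w => ⟨fun hw => ((hIcc _ _).1 ((hmem _ w).1 ⟨hlo.1, hw⟩)).2,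
    fun hw => ((hmem (fun i => lo (.inl i)) w).2
      ((hIcc _ _).2 ⟨⟨fun i => le_rfl, fun i => hle _⟩, hw⟩)).2⟩⟩⟩

theorem mainTheorem9 {n m p : ℕ} (A : Matrix (Fin n) (Fin n) ℝ)
    (B : Matrix (Fin n) (Fin m) ℝ) (C : Matrix (Fin n) (Fin p) ℝ)
    (U : Set (Fin m → ℝ)) (W : Set (Fin p → ℝ))
    (hUW : IsHyperrectangle (jointInputSet U W))
    (hZ : (0 : Fin n → ℝ) ∈ interior (dualInputSet B C U W))
    (hA : ∀ μ ∈ eigenvalueSet A, μ.re = 0) :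
    IsResilient A B C U W := by
  intro xgoal x₀ w hw
  obtain ⟨⟨aU, bU, hU⟩, ⟨aW, bW, hW⟩⟩ := exists_eq_Icc_of_isHyperrectangle_jointInputSet hUW
  obtain ⟨δ, hδ, hball⟩ := Metric.nhds_basis_closedBall.mem_iff.1 (mem_interior_iff_mem_nhds.1 hZ)
  obtain ⟨T, hT, z, x, hzc, hzb, hx0, hxT, hx⟩ := exists_steering_of_re_eq_zero A hA hδ x₀ xgoal
  -- Balls in the sup norm are boxes, so the pairs `(z, w)` range over a box.
  have hzbox : ∀ v : Fin n → ℝ, ‖v‖ ≤ δ ↔ v ∈ Icc (fun _ => -δ) (fun _ => δ) := fun v => by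
    rw [pi_norm_le_iff_of_nonneg hδ.le]
    simp only [Real.norm_eq_abs, abs_le, mem_Icc, Pi.le_def, forall_and]
  have hbox : ∀ v v', v ∈ Icc (fun _ : Fin n => -δ) (fun _ => δ) ∧ v' ∈ Icc aW bW ↔
      Sum.elim v v' ∈ Icc (Sum.elim (fun _ : Fin n => -δ) aW) (Sum.elim (fun _ => δ) bW) :=
    fun v v' => by
      simp only [mem_Icc, Pi.le_def, Sum.forall, Sum.elim_inl, Sum.elim_inr]
      tauto
  obtain ⟨φ, hφc, hφ⟩ := exists_continuous_selection
    (LinearMap.funLeft ℝ ℝ Sum.inl - Matrix.toLin' C ∘ₗ LinearMap.funLeft ℝ ℝ Sum.inr)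
    (Matrix.toLin' B) (U := U) (by rw [hU]; exact convex_Icc _ _)
    (lo := Sum.elim (fun _ : Fin n => -δ) aW) (hi := Sum.elim (fun _ => δ) bW) (fun s hs => by
      rw [← Sum.elim_comp_inl_inr s, ← hbox, ← hW, ← hzbox] at hs
      obtain ⟨u, hu, he⟩ := (hball (mem_closedBall_zero_iff.2 hs.1)).2 _ ⟨_, hs.2, rfl⟩
      refine ⟨u, hu, ?_⟩
      rw [Matrix.toLin'_apply, ← he, Matrix.neg_mulVec, ← sub_eq_add_neg]
      rfl)
  have hφ : ∀ t, 0 ≤ t → φ (Sum.elim (z t) (w t)) ∈ U ∧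
      B.mulVec (φ (Sum.elim (z t) (w t))) = z t - C.mulVec (w t) := fun t ht =>
    hφ _ ((hbox _ _).1 ⟨(hzbox _).1 (hzb t), hW ▸ hw.2 t ht⟩)
  have hu : IsPiecewiseContinuous fun t => φ (Sum.elim (z t) (w t)) :=
    hw.1.continuous_comp₂ hzc (φ := fun a b => φ (Sum.elim a b)) (hφc.comp (by
      refine continuous_pi fun i => ?_
      cases i <;> simp only [Sum.elim_inl, Sum.elim_inr] <;> fun_prop))
  have hsol : IsSolution A B C x₀ (fun t => φ (Sum.elim (z t) (w t))) w x := by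
    refine ⟨hx0, fun t _ => (hx t).continuousAt.continuousWithinAt, fun t ht _ _ => ?_⟩
    rw [(hφ t ht).2, add_assoc, sub_add_cancel]
    exact (hx t).hasDerivWithinAt
  exact ⟨T, hT, _, ⟨hu, fun t ht => (hφ t ht).1⟩, x, hsol, fun y hy => hsol.eqOn hu hw.1 hy, hxT⟩
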